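/- Let $r=4k+2$ with $k\ge 0$ and let $n\ge 1$. Let $G_{r,n}=\mathbb{Z}_r\wr S_n$ be the group of pairs $\pi=(z,\tau)$, $z=(z_1,\dots,z_n)\in\mathbb{Z}_r^n$, $\tau\in S_n$, with product $(z,\tau)(z',\tau')=((z_i+z'_{\tau^{-1}(i)})_i,\ \tau\tau')$. Write $z_i(\pi)=z_i\in\{0,\dots,r-1\}$ (the color of the digit $i$) and $|\pi|=\tau$. Let $s_0=((1,0,\dots,0),\mathrm{id})$ and, for $1\le i\le n-1$, $s_i=(0,(i\ \,i{+}1))$; these generate $G_{r,n}$. Let $A_{r,n}$ be the kernel of the homomorphism $G_{r,n}\to\{\pm1\}$ that sends every $s_i$, $0\le i\le n-1$, to $-1$. It is generated by $\mathcal{A}=\{a_0,a_1,a_1^{-1},a_2,\dots,a_{n-1}\}$, where $a_0=s_0^2$ and $a_i=s_0^{r/2}s_i$ for $1\le i\le n-1$ (for $n=1$, $\mathcal A=\{a_0\}$). Let $\ell_{\mathcal A}(\pi)$ be the minimal number of factors in an expression of $\pi\in A_{r,n}$ as a product of elements of $\mathcal{A}$. For an integer $a\ge 0$ let $a\oslash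 2\in\{0,\dots,\frac r2-1\}$ be the residue modulo $\frac r2$ of $\frac a2$ if $a$ is even, and of $\frac{a+r/2}{2}$ if $a$ is odd. Let $p:A_{r,n}\to G_{r/2,n}$ be the map $(z,\tau)\mapsto((z_i\oslash 2)_i,\tau)$, and let $s:G_{r/2,n}\to A_{r,n}$ be its section that sends $(c,\tau)$ to $(z,\tau)$ with $z_i\equiv 2c_i \pmod r$ for all $i$, except that $z_1\equiv 2c_1+\frac r2 \pmod r$ if $\mathrm{inv}(\tau)$ is odd. The fibral length of $\pi\in A_{r,n}$ is the integer $\ell_F(\pi)=\ell_{\mathcal A}(\pi)-\ell_{\mathcal A}(s(p(\pi)))$. Theorem. Let $\pi\in A_{r,n}$. For $2\le i\le n$ let $l_i=|\{j : j<i,\ |\pi|^{-1}(i)<|\pi|^{-1}(j)\}|$ (the Lehmer code entry of $|\pi|$ at the digit $i$: the number of digits smaller than $i$ to the right of $i$ in the one-line notation of $|\pi|$), and let $\delta_i=1$ if $z_i(\pi)\in\{0,\frac r2\}$ and $\delta_i=0$ otherwise. Then $$\sum_{\sigma\in p^{-1}(p(\pi))}q^{\ell_F(\sigma)}=\prod_{i=2}^{n}\left(1+q^{2\delta_i(i-1-l_i)}\right).$$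 -/

import Mathlib

noncomputable section

namespace ColoredPerm

open Finset

/-- The group of colored permutations `ℤ_r ≀ S_n = ℤ_r^n ⋊ S_n`, consisting of the pairs `(z, τ)`
with `(z, τ) (z', τ') = (i ↦ z i + z' (τ⁻¹ i), τ ∘ τ')` (see `color_mul`, `perm_mul`).
The digits `1, …, n` are the elements `0, …, n - 1` of `Fin n`: digit `i + 1` is `i : Fin n`. -/
abbrev G (r n : ℕ) : Type :=
  (Fin n → Multiplicative (ZMod r)) ⋊[mulAutArrow] Equiv.Perm (Fin n)

/-- The pair `(z, τ)` as an element of `G r n`. -/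
def mkG {r n : ℕ} (z : Fin n → ZMod r) (τ : Equiv.Perm (Fin n)) : G r n :=
  ⟨fun i => Multiplicative.ofAdd (z i), τ⟩

/-- The vector `z` of the colored permutation `g = (z, τ)`, with entries modulo `r`;
`zvec g i` is the color of the digit `i` (`i` is a value, not a place). -/
def zvec {r n : ℕ} (g : G r n) (i : Fin n) : ZMod r := Multiplicative.toAdd (g.left i)

/-- `z_i(g)`, the color of the digit `i`, as an integer between `0` and `r - 1`. -/
def color {r n : ℕ} (g : G r n) (i : Fin n) : ℕ := (zvec g i).val

/-- The underlying permutation `|g| = τ` of `g = (z, τ)`. -/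
def perm {r n : ℕ} (g : G r n) : Equiv.Perm (Fin n) := g.right

theorem zvec_mul {r n : ℕ} (g h : G r n) (i : Fin n) :
    zvec (g * h) i = zvec g i + zvec h ((perm g)⁻¹ i) := rfl

theorem perm_mul {r n : ℕ} (g h : G r n) : perm (g * h) = perm g * perm h := rfl

theorem zvec_mkG {r n : ℕ} (z : Fin n → ZMod r) (τ : Equiv.Perm (Fin n)) (i : Fin n) :
    zvec (mkG z τ) i = z i := rfl

theorem perm_mkG {r n : ℕ} (z : Fin n → ZMod r) (τ : Equiv.Perm (Fin n)) :
    perm (mkG z τ) = τ := rfl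

theorem ext_G {r n : ℕ} {g h : G r n} (hz : ∀ i, zvec g i = zvec h i) (hp : perm g = perm h) :
    g = h := SemidirectProduct.ext (funext hz) hp

/-- There are finitely many colored permutations. -/
instance finite_G {r n : ℕ} [NeZero r] : Finite (G r n) :=
  Finite.of_injective (fun g : G r n => (zvec g, perm g)) fun _ _ hgh =>
    ext_G (fun i => congrFun (congrArg Prod.fst hgh) i) (congrArg Prod.snd hgh)

/-- The generators `s_0, …, s_{n-1}` of `G r n`: `s_0` gives the smallest digit the color `1` and
fixes everything else, while for `1 ≤ i ≤ n - 1`, `s_i` exchanges the `i`-th and the `(i+1)`-st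
digit, which are the elements `i - 1` and `i` of `Fin n`. -/
def sGen {r n : ℕ} (i : Fin n) : G r n :=
  if (i : ℕ) = 0 then mkG (Pi.single i 1) 1
  else mkG 0 (Equiv.swap ⟨(i : ℕ) - 1, by omega⟩ i)

/-- The first element of `Fin n`, when some `i : Fin n` is given. -/
def firstDigit {n : ℕ} (i : Fin n) : Fin n := ⟨0, i.pos⟩

/-- The inversion number of a permutation. -/
def invCount {n : ℕ} (τ : Equiv.Perm (Fin n)) : ℕ :=
  #{x : Fin n × Fin n | x.1 < x.2 ∧ τ x.2 < τ x.1}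

theorem sign_eq_neg_one_pow_invCount {n : ℕ} (τ : Equiv.Perm (Fin n)) :
    Equiv.Perm.sign τ = (-1) ^ invCount τ := by
  have h : ∀ x y : Fin n, x < y → (if τ x < τ y then (1 : ℤˣ) else -1) =
      if τ y < τ x then -1 else 1 := by
    intro x y hxy
    have hne : τ x ≠ τ y := fun e => hxy.ne (τ.injective e)
    rcases lt_or_gt_of_ne hne with h1 | h1
    · simp [h1, h1.not_gt]
    · simp [h1, h1.not_gt]
  rw [Equiv.Perm.sign_eq_prod_prod_Ioi]
  have h2 : ∀ x : Fin n, (∏ y ∈ Ioi x, if τ x < τ y then (1 : ℤˣ) else -1) =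
      ∏ y, if x < y ∧ τ y < τ x then -1 else 1 := by
    intro x
    rw [Finset.prod_congr rfl fun y hy => h x y (mem_Ioi.1 hy), ← Finset.filter_lt_eq_Ioi,
      Finset.prod_filter]
    refine Finset.prod_congr rfl fun y _ => ?_
    by_cases hxy : x < y <;> simp [hxy]
  rw [Finset.prod_congr rfl fun x _ => h2 x, ← Fintype.prod_prod_type', Finset.prod_ite]
  simp [invCount]

theorem neZero_of_mod {r : ℕ} [h : Fact (r % 4 = 2)] : NeZero r :=
  ⟨by have := h.out; omega⟩

theorem neg_one_pow_val_add {r : ℕ} [h : Fact (r % 4 = 2)] (a b : ZMod r) :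
    (-1 : ℤˣ) ^ (a + b).val = (-1) ^ a.val * (-1) ^ b.val := by
  have := neZero_of_mod (r := r)
  have h2 : 2 ∣ r := by have := h.out; omega
  have h3 : ∀ m : ℕ, (-1 : ℤˣ) ^ m = (-1) ^ (m % 2) := fun m =>
    by
    conv_lhs => rw [← Nat.mod_add_div m 2]
    simp [pow_add, pow_mul]
  rw [ZMod.val_add, ← pow_add, h3, Nat.mod_mod_of_dvd _ h2, ← h3]

/-- The character `φ` of `G r n` with `φ(s_i) = -1` for all `0 ≤ i ≤ n - 1`
(see `signChar_sGen` and `eq_signChar`). -/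
def signChar (r n : ℕ) [Fact (r % 4 = 2)] : G r n →* ℤˣ where
  toFun g := (∏ i, (-1) ^ color g i) * Equiv.Perm.sign (perm g)
  map_one' := by
    have h : ∀ i, color (1 : G r n) i = 0 := fun i => ZMod.val_zero
    have h' : perm (1 : G r n) = 1 := rfl
    simp [h, h']
  map_mul' g h := by
    simp only [color, zvec_mul, neg_one_pow_val_add, prod_mul_distrib, perm_mul, map_mul]
    rw [Equiv.prod_comp (perm g)⁻¹ (fun i => (-1 : ℤˣ) ^ (zvec h i).val)]
    exact mul_mul_mul_comm _ _ _ _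

theorem signChar_mkG {r n : ℕ} [Fact (r % 4 = 2)] (z : Fin n → ZMod r)
    (τ : Equiv.Perm (Fin n)) :
    signChar r n (mkG z τ) = (∏ i, (-1) ^ (z i).val) * Equiv.Perm.sign τ := rfl

theorem val_one_of_mod {r : ℕ} [h : Fact (r % 4 = 2)] : (1 : ZMod r).val = 1 := by
  have h1 := h.out
  have : Fact (1 < r) := ⟨by omega⟩
  exact ZMod.val_one r

theorem signChar_sGen {r n : ℕ} [Fact (r % 4 = 2)] (i : Fin n) :
    signChar r n (sGen i) = -1 := by
  unfold sGen
  split_ifs with hi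
  · rw [signChar_mkG, Finset.prod_eq_single i]
    · simp [val_one_of_mod]
    · intro j _ hj
      simp [hj]
    · simp
  · rw [signChar_mkG, Equiv.Perm.sign_swap]
    · simp
    · intro h
      have := congrArg Fin.val h
      simp only at this
      omega

/-- `signChar` is the only character that sends every `s_i` to `-1`. -/
theorem eq_signChar {r n : ℕ} [Fact (r % 4 = 2)] (φ : G r n →* ℤˣ)
    (hφ : ∀ i, φ (sGen i) = -1) : φ = signChar r n := by
  have := neZero_of_mod (r := r)
  set ψ := signChar r n with hψ
  have hs : ∀ i, φ (sGen i) = ψ (sGen i) := fun i => by rw [hφ, hψ, signChar_sGen]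
  -- the two characters agree on the permutations
  have hperm : ∀ τ : Equiv.Perm (Fin n), φ (mkG 0 τ) = ψ (mkG 0 τ) := by
    have key : φ.comp SemidirectProduct.inr = ψ.comp SemidirectProduct.inr := by
      cases n with
      | zero =>
        ext τ
        rw [Subsingleton.elim τ 1, map_one, map_one]
      | succ n =>
        refine MonoidHom.eq_of_eqOn_denseM
          (Equiv.Perm.mclosure_swap_castSucc_succ n) ?_
        rintro _ ⟨i, rfl⟩
        have h1 : (sGen i.succ : G r (n + 1)) =
            SemidirectProduct.inr (Equiv.swap i.castSucc i.succ) := by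
          rw [sGen, if_neg (by simp)]
          rfl
        simpa [h1] using hs i.succ
    exact fun τ => DFunLike.congr_fun key τ
  -- and on a single color of a single digit
  have hone : ∀ i : Fin n, φ (mkG (Pi.single i 1) 1) = ψ (mkG (Pi.single i 1) 1) := by
    intro i
    have h1 : (mkG (Pi.single i 1) 1 : G r n) =
        mkG 0 (Equiv.swap (firstDigit i) i) * sGen (firstDigit i) *
          mkG 0 (Equiv.swap (firstDigit i) i) := by
      rw [sGen, if_pos (show ((firstDigit i : Fin n) : ℕ) = 0 from rfl)]
      refine ext_G (fun j => ?_) ?_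
      · simp only [zvec_mul, zvec_mkG, perm_mkG, Pi.zero_apply, zero_add, add_zero, perm_mul,
          Equiv.swap_inv, Pi.single_apply]
        congr 1
        rw [Equiv.swap_apply_eq_iff, Equiv.swap_apply_left]
      · simp [perm_mul, perm_mkG]
    rw [h1, map_mul, map_mul, map_mul, map_mul, hs, hperm]
  have hmk : ∀ z w : Fin n → ZMod r, (mkG (z + w) 1 : G r n) = mkG z 1 * mkG w 1 :=
    fun _ _ => rfl
  have hcol : ∀ z : Fin n → ZMod r, φ (mkG z 1) = ψ (mkG z 1) := by
    intro z
    have hsingle : ∀ (i : Fin n) (m : ℕ),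
        φ (mkG (Pi.single i (m : ZMod r)) 1) = ψ (mkG (Pi.single i (m : ZMod r)) 1) := by
      intro i m
      induction m with
      | zero =>
        rw [Nat.cast_zero, Pi.single_zero]
        exact hperm 1
      | succ m ih =>
        rw [Nat.cast_succ, Pi.single_add, hmk, map_mul, map_mul, ih, hone]
    rw [← Finset.univ_sum_single z]
    generalize (univ : Finset (Fin n)) = t
    induction t using Finset.induction_on with
    | empty => exact hperm 1
    | insert i t hi ih =>
      rw [Finset.sum_insert hi, hmk, map_mul, map_mul, ih]
      have := hsingle i (z i).val
      rw [ZMod.natCast_zmod_val] at this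
      rw [this]
  ext g
  have hg : g = mkG (zvec g) 1 * mkG 0 (perm g) := by
    refine ext_G (fun i => ?_) ?_
    · simp [zvec_mul, zvec_mkG]
    · simp [perm_mul, perm_mkG]
  rw [hg, map_mul, map_mul, hcol, hperm]

/-- The group `A_{r,n} = ker φ` of alternating colored permutations, for `r = 4k + 2`. -/
def A (r n : ℕ) [Fact (r % 4 = 2)] : Subgroup (G r n) := (signChar r n).ker

theorem aGen_mem {r n : ℕ} [h : Fact (r % 4 = 2)] (i : Fin n) :
    (if (i : ℕ) = 0 then sGen i ^ 2 else sGen (firstDigit i) ^ (r / 2) * sGen i) ∈ A r n := by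
  have hodd : Odd (r / 2) := by
    have := h.out
    rw [Nat.odd_iff]
    omega
  rw [A, MonoidHom.mem_ker]
  split_ifs
  · simp [signChar_sGen]
  · simp [signChar_sGen, hodd.neg_one_pow]

/-- The elements `a_0 = s_0 ^ 2` and `a_i = s_0 ^ (r/2) * s_i` (`1 ≤ i ≤ n - 1`) of `A r n`. -/
def aGen {r n : ℕ} [Fact (r % 4 = 2)] (i : Fin n) : A r n :=
  ⟨if (i : ℕ) = 0 then sGen i ^ 2 else sGen (firstDigit i) ^ (r / 2) * sGen i, aGen_mem i⟩

/-- The generating set `{a_0, a_1, a_1⁻¹, a_2, …, a_{n-1}}` of `A r n`. -/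
def aGenSet (r n : ℕ) [Fact (r % 4 = 2)] : Set (A r n) :=
  {g | ∃ i, g = aGen i} ∪ {g | ∃ i : Fin n, (i : ℕ) = 1 ∧ g = (aGen i)⁻¹}

/-- The length of `g` with respect to `S`: the least `u` such that `g` is a product of `u`
elements of `S`. -/
def wordLength {H : Type*} [Group H] (S : Set H) (g : H) : ℕ :=
  sInf {u | ∃ w : List H, w.length = u ∧ (∀ x ∈ w, x ∈ S) ∧ w.prod = g}

/-- The length function of `A r n` with respect to `{a_0, a_1, a_1⁻¹, a_2, …, a_{n-1}}`. -/
def lengthA {r n : ℕ} [Fact (r % 4 = 2)] (g : A r n) : ℕ := wordLength (aGenSet r n) g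

/-- The operation `a ⊘ 2`: the representative modulo `r/2`, between `0` and `r/2 - 1`, of
`a/2` for even `a` and of `(a + r/2)/2` for odd `a` (all divisions are exact when `r = 4k + 2`). -/
def oslash (r a : ℕ) : ℕ :=
  if a % 2 = 0 then (a / 2) % (r / 2) else ((a + r / 2) / 2) % (r / 2)

/-- The covering map `p : A_{r,n} → G_{r/2,n}`, which replaces every color `c` by `c ⊘ 2`. -/
def p {r n : ℕ} [Fact (r % 4 = 2)] (g : A r n) : G (r / 2) n :=
  mkG (fun i => (oslash r (color (g : G r n) i) : ZMod (r / 2))) (perm (g : G r n))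

/-- The colors of the section: every color `c` is doubled, and if the inversion number of the
underlying permutation is odd, then `r/2` is added to the color of the smallest digit. -/
def sectionColor {r n : ℕ} (g : G (r / 2) n) (i : Fin n) : ZMod r :=
  if (i : ℕ) = 0 ∧ invCount (perm g) % 2 = 1 then ((2 * color g i + r / 2 : ℕ) : ZMod r)
  else ((2 * color g i : ℕ) : ZMod r)

theorem section_mem {r n : ℕ} [h : Fact (r % 4 = 2)] (g : G (r / 2) n) :
    mkG (sectionColor g) (perm g) ∈ A r n := by
  have hr := h.out
  have hpar : ∀ m : ℕ, (-1 : ℤˣ) ^ (m : ZMod r).val = (-1) ^ m := by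
    intro m
    have h3 : ∀ m : ℕ, (-1 : ℤˣ) ^ m = (-1) ^ (m % 2) := fun m => by
      conv_lhs => rw [← Nat.mod_add_div m 2]
      simp [pow_add, pow_mul]
    rw [ZMod.val_natCast, h3, Nat.mod_mod_of_dvd _ (by omega), ← h3]
  have hodd : Odd (r / 2) := by
    rw [Nat.odd_iff]
    omega
  have hcol : ∀ i, (-1 : ℤˣ) ^ (sectionColor g i).val =
      if (i : ℕ) = 0 ∧ invCount (perm g) % 2 = 1 then -1 else 1 := by
    intro i
    unfold sectionColor
    split_ifs
    · rw [hpar, pow_add, pow_mul, hodd.neg_one_pow]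
      simp
    · rw [hpar, pow_mul]
      simp
  rw [A, MonoidHom.mem_ker, signChar_mkG, Finset.prod_congr rfl fun i _ => hcol i,
    sign_eq_neg_one_pow_invCount]
  rcases Nat.even_or_odd (invCount (perm g)) with he | ho
  · simp [he.neg_one_pow, Nat.even_iff.1 he]
  · have hn : 0 < n := by
      rcases Nat.eq_zero_or_pos n with rfl | hn
      · simp [invCount] at ho
      · exact hn
    rw [Finset.prod_eq_single (⟨0, hn⟩ : Fin n)]
    · simp [ho.neg_one_pow, Nat.odd_iff.1 ho]
    · intro i _ hi
      rw [if_neg]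
      rintro ⟨h0, -⟩
      exact hi (Fin.ext h0)
    · simp

/-- The section `s : G_{r/2,n} → A_{r,n}` of the covering map. -/
def sec {r n : ℕ} [Fact (r % 4 = 2)] (g : G (r / 2) n) : A r n :=
  ⟨mkG (sectionColor g) (perm g), section_mem g⟩

/-- The fibral length `ℓ_F(g) = ℓ_𝒜(g) - ℓ_𝒜(s(p(g)))`, a difference of integers. -/
def fibralLength {r n : ℕ} [Fact (r % 4 = 2)] (g : A r n) : ℤ :=
  (lengthA g : ℤ) - (lengthA (sec (p g)) : ℤ)

/-- The fiber `p⁻¹(p(π))` of the covering map through `π`. -/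
def fiber {r n : ℕ} [Fact (r % 4 = 2)] (π : A r n) : Set (A r n) := {σ | p σ = p π}

theorem fiber_finite {r n : ℕ} [Fact (r % 4 = 2)] (π : A r n) : (fiber π).Finite :=
  have := neZero_of_mod (r := r)
  Set.toFinite _

/-- The distribution `F(π) = ∑ q ^ ℓ_F(σ)`, over all `σ` in the finite fiber `p⁻¹(p(π))`, as a
Laurent polynomial in `q` with integer coefficients (`T k` is the monomial `q ^ k`). -/
def fiberDistribution {r n : ℕ} [Fact (r % 4 = 2)] (π : A r n) : LaurentPolynomial ℤ :=
  ∑ σ ∈ (fiber_finite π).toFinset, LaurentPolynomial.T (fibralLength σ)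

/-- The entry `l_i` of the Lehmer code of `τ`: the number of digits smaller than `i` that stand to
the right of `i` in the window notation of `τ`. -/
def lehmer {n : ℕ} (τ : Equiv.Perm (Fin n)) (i : Fin n) : ℕ :=
  #{j : Fin n | j < i ∧ τ⁻¹ i < τ⁻¹ j}

/-- `δ_i(g)` is `1` if `z_i(g) ∈ {0, r/2}`, and `0` otherwise. -/
def delta {r n : ℕ} (g : G r n) (i : Fin n) : ℕ :=
  if color g i = 0 ∨ color g i = r / 2 then 1 else 0

end ColoredPerm

end

namespace ColoredPerm

open Finset

/-! ### Word length characterised by descents -/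

section WordLength

variable {H : Type*} [Group H] {S : Set H} {L : H → ℕ}

/-! The core is an explicit length formula, `lengthA_eq_weight`. The weight of `g` is the sum of the
halved colors plus a cost for every pair of digits j < i: 1 if i stands to the left of j, otherwise
0 or 2 according to whether the color of i is zero or not. No generator raises the weight by more
than 1 (`weight_mul_le`), and every nontrivial element of `A r n` admits a generator whose removal
on the right lowers it by 1 (`exists_descent`), so the weight is the word length.

Elements of one fiber share the permutation and the halved colors, so their weights differ only
through the indicators "z_i = 0". Making z_i nonzero costs 2 for each smaller digit to the left of
i, that is 2(i - 1 - l_i) for the digit i counted from 1 (`weight_sub_weight`). The section gives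
digits other than the smallest an even color, which vanishes exactly when its half does; hence
moving z_i away from the section by r/2 changes the length only if δ_i = 1.

Finally, a fiber is a torsor under the even-size sets of digits whose colors are shifted by r/2. As
the smallest digit absorbs the parity and contributes nothing to the length difference, the fiber is
in bijection with the arbitrary subsets of the other digits (`diffSet_injOn`, `exists_diffSet_eq`).
The fibral length is additive over the subset, so the sum over subsets factors into the stated
product. -/

theorem le_length_of_prod (h1 : L 1 = 0) (hstep : ∀ g, ∀ s ∈ S, L (g * s) ≤ L g + 1)
    (w : List H) (hw : ∀ x ∈ w, x ∈ S) : L w.prod ≤ w.length := by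
  induction w using List.reverseRecOn with
  | nil => simp [h1]
  | append_singleton w s ih =>
    have h2 := ih fun x hx => hw x (by simp [hx])
    have h3 := hstep w.prod s (hw s (by simp))
    simp only [List.prod_append, List.prod_singleton, List.length_append, List.length_singleton]
    omega

theorem exists_word_of_descent
    (hdesc : ∀ g, g ≠ 1 → ∃ s ∈ S, L (g * s⁻¹) + 1 = L g) (g : H) :
    ∃ w : List H, w.length ≤ L g ∧ (∀ x ∈ w, x ∈ S) ∧ w.prod = g := by
  induction hL : L g generalizing g with
  | zero =>
    refine ⟨[], by simp, by simp, ?_⟩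
    by_contra hne
    obtain ⟨s, -, hs⟩ := hdesc g (Ne.symm hne)
    omega
  | succ u ih =>
    by_cases hg : g = 1
    · exact ⟨[], by simp, by simp, by simp [hg]⟩
    obtain ⟨s, hs, hLs⟩ := hdesc g hg
    obtain ⟨w, hlen, hw, hprod⟩ := ih (g * s⁻¹) (by omega)
    refine ⟨w ++ [s], by simpa using hlen, ?_, by simp [hprod]⟩
    intro x hx
    rcases List.mem_append.1 hx with hx | hx
    · exact hw x hx
    · rwa [List.mem_singleton.1 hx]

/-- A function that vanishes at `1`, grows by at most one under right multiplication by a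
generator and admits a descent at every other element is the word length. -/
theorem wordLength_eq_of_descent (h1 : L 1 = 0)
    (hstep : ∀ g, ∀ s ∈ S, L (g * s) ≤ L g + 1)
    (hdesc : ∀ g, g ≠ 1 → ∃ s ∈ S, L (g * s⁻¹) + 1 = L g) (g : H) :
    wordLength S g = L g := by
  obtain ⟨w, hlen, hw, hprod⟩ := exists_word_of_descent hdesc g
  apply le_antisymm
  · have hle : wordLength S g ≤ w.length := Nat.sInf_le ⟨w, rfl, hw, hprod⟩
    exact hle.trans hlen
  · refine le_csInf (Set.nonempty_of_mem (x := w.length) ⟨w, rfl, hw, hprod⟩) ?_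
    rintro _ ⟨w', rfl, hw', rfl⟩
    exact le_length_of_prod h1 hstep w' hw'

end WordLength

/-! ### Halving colors modulo the odd number r/2 -/

section Half

variable {r : ℕ}

/-- The operation `a ⊘ 2` on residues modulo `r`. -/
def half (a : ZMod r) : ℕ := oslash r a.val

theorem half_zero : half (0 : ZMod r) = 0 := by simp [half, oslash]

variable [h : Fact (r % 4 = 2)]

/-- Since r/2 is odd, parity leaves a single possible alternative for each x, so these linear facts
determine x ⊘ 2 and later arguments can be left to linear arithmetic. -/
theorem oslash_spec {x : ℕ} (hx : x < r) :
    oslash r x < r / 2 ∧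
      (2 * oslash r x = x ∨ 2 * oslash r x = x + r / 2 ∨ 2 * oslash r x + r / 2 = x) := by
  have hr := h.out
  unfold oslash
  split_ifs with h2
  · rw [Nat.mod_eq_of_lt (by omega)]
    omega
  · rcases lt_or_ge x (r / 2) with hlt | hge
    · rw [Nat.mod_eq_of_lt (by omega)]
      omega
    · rw [Nat.mod_eq_sub_mod (by omega), Nat.mod_eq_of_lt (by omega)]
      omega

theorem val_lt_of_mod (a : ZMod r) : a.val < r :=
  have := neZero_of_mod (r := r)
  ZMod.val_lt a

theorem half_lt (a : ZMod r) : half a < r / 2 := (oslash_spec (val_lt_of_mod a)).1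

theorem val_add_natCast (a : ZMod r) (m : ℕ) (hm : m ≤ r) :
    (a + (m : ZMod r)).val = a.val + m ∨ (a + (m : ZMod r)).val + r = a.val + m := by
  have := neZero_of_mod (r := r)
  have ha := val_lt_of_mod a
  have h1 : a + (m : ZMod r) = ((a.val + m : ℕ) : ZMod r) := by simp
  rw [h1, ZMod.val_natCast]
  rcases lt_or_ge (a.val + m) r with hlt | hge
  · exact Or.inl (Nat.mod_eq_of_lt hlt)
  · rcases (Nat.lt_or_ge (a.val + m - r) r) with h2 | h2
    · rw [Nat.mod_eq_sub_mod hge, Nat.mod_eq_of_lt h2]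
      omega
    · omega

theorem half_add_half (a : ZMod r) : half (a + ((r / 2 : ℕ) : ZMod r)) = half a := by
  have hr := h.out
  have h1 := oslash_spec (val_lt_of_mod a)
  have h2 := oslash_spec (val_lt_of_mod (a + ((r / 2 : ℕ) : ZMod r)))
  have h3 := val_lt_of_mod a
  have h4 := val_lt_of_mod (a + ((r / 2 : ℕ) : ZMod r))
  unfold half
  rcases val_add_natCast a (r / 2) (by omega) with h5 | h5 <;> omega

theorem half_add_two (a : ZMod r) : half (a + 2) = 0 ∨ half (a + 2) = half a + 1 := by
  have hr := h.out
  have h1 := oslash_spec (val_lt_of_mod a)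
  have h2 := oslash_spec (val_lt_of_mod (a + 2))
  have h3 := val_lt_of_mod a
  have h4 := val_lt_of_mod (a + 2)
  unfold half
  rcases val_add_natCast a 2 (by omega) with h5 | h5 <;> push_cast at h5 <;> omega

theorem val_half_of_mod : ((r / 2 : ℕ) : ZMod r).val = r / 2 := by
  have hr := h.out
  rw [ZMod.val_natCast, Nat.mod_eq_of_lt (by omega)]

theorem natCast_half_ne_zero : ((r / 2 : ℕ) : ZMod r) ≠ 0 := by
  have hr := h.out
  intro h0
  have h1 := val_half_of_mod (r := r)
  rw [h0, ZMod.val_zero] at h1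
  omega

theorem natCast_half_add_self : ((r / 2 : ℕ) : ZMod r) + (r / 2 : ℕ) = 0 := by
  have hr := h.out
  rw [← Nat.cast_add, ZMod.natCast_eq_zero_iff]
  exact dvd_of_eq (by omega)

theorem half_two_mul {c : ℕ} (hc : c < r / 2) : half ((2 * c : ℕ) : ZMod r) = c := by
  have hr := h.out
  have h1 := oslash_spec (r := r) (x := 2 * c) (by omega)
  rw [half, ZMod.val_natCast, Nat.mod_eq_of_lt (by omega)]
  omega

/-- Halving modulo r/2 is invertible, so it loses only the difference between residues congruent
modulo r/2. -/
theorem eq_or_eq_add_half {a b : ZMod r} (hab : half a = half b) :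
    b = a ∨ b = a + (r / 2 : ℕ) := by
  have hr := h.out
  have := neZero_of_mod (r := r)
  have h1 := oslash_spec (val_lt_of_mod a)
  have h2 := oslash_spec (val_lt_of_mod b)
  have h3 := val_lt_of_mod a
  have h4 := val_lt_of_mod b
  have h6 := val_lt_of_mod (a + ((r / 2 : ℕ) : ZMod r))
  unfold half at hab
  by_cases hv : b.val = a.val
  · exact Or.inl (ZMod.val_injective r hv)
  · right
    apply ZMod.val_injective r
    rcases val_add_natCast a (r / 2) (by omega) with h5 | h5 <;> omega

theorem half_eq_zero_iff {a : ZMod r} : half a = 0 ↔ a = 0 ∨ a = (r / 2 : ℕ) := by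
  constructor
  · intro ha
    simpa using eq_or_eq_add_half (a := 0) (b := a) (by rw [ha, half_zero])
  · rintro (rfl | rfl)
    · exact half_zero
    · simpa [half_zero] using half_add_half (0 : ZMod r)

theorem neg_one_pow_val_half : (-1 : ℤˣ) ^ ((r / 2 : ℕ) : ZMod r).val = -1 := by
  have hr := h.out
  have hodd : Odd (r / 2) := by
    rw [Nat.odd_iff]
    omega
  rw [val_half_of_mod, hodd.neg_one_pow]

end Half

/-! ### Parity constraint defining the alternating subgroup -/

section Kernel

variable {r n : ℕ}

theorem color_eq (g : G r n) (i : Fin n) : color g i = (zvec g i).val := rfl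

variable [h : Fact (r % 4 = 2)]

theorem signChar_apply (g : G r n) :
    signChar r n g = (∏ i, (-1) ^ (zvec g i).val) * Equiv.Perm.sign (perm g) := rfl

/-- An element of `A r n` is determined by its permutation, the colors of the digits other than
`i₀`, and `z ⊘ 2` for the color `z` of `i₀`. -/
theorem eq_of_zvec_eq_off {g g' : G r n} (hg : g ∈ A r n) (hg' : g' ∈ A r n) (i₀ : Fin n)
    (hp : perm g = perm g') (hz : ∀ i, i ≠ i₀ → zvec g i = zvec g' i)
    (h0 : half (zvec g i₀) = half (zvec g' i₀)) : g = g' := by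
  refine ext_G (fun i => ?_) hp
  by_cases hi : i = i₀
  · subst hi
    rcases eq_or_eq_add_half h0 with h1 | h1
    · exact h1.symm
    -- Shifting a single color by the odd number r/2 flips the sign character, which is impossible
    -- inside its kernel.
    · exfalso
      have hprod : ∏ j ∈ univ.erase i, (-1 : ℤˣ) ^ (zvec g j).val =
          ∏ j ∈ univ.erase i, (-1) ^ (zvec g' j).val :=
        Finset.prod_congr rfl fun j hj => by rw [hz j (ne_of_mem_erase hj)]
      rw [A, MonoidHom.mem_ker, signChar_apply, ← Finset.mul_prod_erase _ _ (mem_univ i)] at hg hg'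
      rw [← hp, h1, neg_one_pow_val_add, neg_one_pow_val_half,
        ← hprod, mul_neg_one,
        neg_mul, neg_mul, hg] at hg'
      exact absurd hg' (by decide)
  · exact hz i hi

theorem delta_eq (g : G r n) (i : Fin n) :
    delta g i = if half (zvec g i) = 0 then 1 else 0 := by
  have := neZero_of_mod (r := r)
  have h1 : (zvec g i).val = r / 2 ↔ zvec g i = (r / 2 : ℕ) := by
    exact ⟨fun e => ZMod.val_injective r (by rw [e, val_half_of_mod]),
      fun e => by rw [e, val_half_of_mod]⟩
  simp only [delta, color_eq, ZMod.val_eq_zero, h1, half_eq_zero_iff]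

end Kernel

/-! ### The weight and its change under colored swaps -/

section Weight

variable {r n : ℕ}

/-- The contribution of the ordered pair of digits `x = (i, j)` to the length of `g`. -/
def pairCost (g : G r n) (x : Fin n × Fin n) : ℕ :=
  if x.2 < x.1 then
    if (perm g)⁻¹ x.1 < (perm g)⁻¹ x.2 then 1 else if zvec g x.1 = 0 then 0 else 2
  else 0

/-- The combinatorial length formula on `A r n`. -/
def weight (g : G r n) : ℕ := ∑ i, half (zvec g i) + ∑ x, pairCost g x

theorem weight_one : weight (1 : G r n) = 0 := by
  have hz : ∀ i, zvec (1 : G r n) i = 0 := fun _ => rfl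
  have hp : perm (1 : G r n) = 1 := rfl
  simp only [weight, pairCost, hz, hp, half_zero, inv_one, Equiv.Perm.one_apply,
    Finset.sum_const_zero, zero_add, if_true, Finset.sum_eq_zero_iff, mem_univ, true_imp_iff]
  rintro ⟨i, j⟩
  by_cases hij : j < i <;> simp [hij, le_of_lt]

theorem swap_lt_swap_iff {u v a b : Fin n} (huv : (v : ℕ) = u + 1)
    (h1 : ¬(a = u ∧ b = v)) (h2 : ¬(a = v ∧ b = u)) :
    Equiv.swap u v a < Equiv.swap u v b ↔ a < b := by
  simp only [Equiv.swap_apply_def, Fin.ext_iff] at *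
  split_ifs <;> simp only [Fin.lt_def] <;> omega

theorem sum_add_eq_sum_add_of_eq_off {α : Type*} [Fintype α] [DecidableEq α] {f f' : α → ℕ}
    (x₀ : α) (h : ∀ x, x ≠ x₀ → f x = f' x) : ∑ x, f x + f' x₀ = ∑ x, f' x + f x₀ := by
  have h1 : ∑ x ∈ univ.erase x₀, f x = ∑ x ∈ univ.erase x₀, f' x :=
    Finset.sum_congr rfl fun x hx => h x (ne_of_mem_erase hx)
  rw [← Finset.add_sum_erase univ f (mem_univ x₀), ← Finset.add_sum_erase univ f' (mem_univ x₀), h1]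
  ring

/-- A colored transposition of the adjacent places `u` and `v = u + 1`, whose colors lie in
`{0, r/2}` and are supported at places that no other place precedes (except that `u` may
precede `v`). -/
structure IsColoredSwap (c : Fin n → ZMod r) (u v : Fin n) : Prop where
  succ : (v : ℕ) = u + 1
  color_eq : ∀ a, c a = 0 ∨ c a = (r / 2 : ℕ)
  lt_of_ne : ∀ a b, c a ≠ 0 → b ≠ a → ¬(a = v ∧ b = u) → a < b

/-- The place preceding a place. -/
def predDigit (i : Fin n) : Fin n := ⟨(i : ℕ) - 1, by omega⟩

/-- The first place serves all the `aGen i` with i ≠ 0; the other choice, a = i with i = 1, serves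
the inverse of `aGen i`. -/
theorem isColoredSwap_single {i a : Fin n} (hi : (i : ℕ) ≠ 0)
    (ha : (a : ℕ) = 0 ∨ ((i : ℕ) = 1 ∧ a = i)) :
    IsColoredSwap (r := r) (Pi.single a ((r / 2 : ℕ) : ZMod r)) (predDigit i) i where
  succ := by
    simp only [predDigit]
    omega
  color_eq b := by
    by_cases hb : b = a
    · exact Or.inr (by rw [hb, Pi.single_eq_same])
    · exact Or.inl (Pi.single_eq_of_ne hb _)
  lt_of_ne b d hb hd hbd := by
    have hba : b = a := by
      by_contra hne
      exact hb (Pi.single_eq_of_ne hne _)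
    subst hba
    rw [Fin.lt_def]
    simp only [Ne, Fin.ext_iff, predDigit] at ha hd hbd ⊢
    omega

theorem inv_perm_mul_apply (c : Fin n → ZMod r) (u v : Fin n) (g : G r n) (i : Fin n) :
    (perm (g * mkG c (Equiv.swap u v)))⁻¹ i = Equiv.swap u v ((perm g)⁻¹ i) := by
  simp [perm_mul, perm_mkG]

theorem mkG_single_pow (a : Fin n) (m : ℕ) :
    (mkG (Pi.single a 1) 1 : G r n) ^ m = mkG (Pi.single a (m : ZMod r)) 1 := by
  induction m with
  | zero =>
    rw [pow_zero, Nat.cast_zero, Pi.single_zero]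
    rfl
  | succ m ih =>
    rw [pow_succ, ih, Nat.cast_succ, Pi.single_add]
    rfl

theorem zvec_mul_single_two (g : G r n) (a : Fin n) :
    zvec (g * mkG (Pi.single a 2) 1) (perm g a) = zvec g (perm g a) + 2 := by
  simp [zvec_mul, zvec_mkG]

/-- Only the digit in the first place is recolored. It stands to the left of all others, so its pair
costs ignore its color. The additive form avoids truncated subtraction. -/
theorem weight_mul_two_add (g : G r n) (a : Fin n) (ha : (a : ℕ) = 0) :
    weight (g * mkG (Pi.single a 2) 1) + half (zvec g (perm g a)) =
      weight g + half (zvec g (perm g a) + 2) := by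
  have hz : ∀ i, zvec (g * mkG (Pi.single a 2) 1) i =
      zvec g i + (Pi.single a 2 : Fin n → ZMod r) ((perm g)⁻¹ i) := fun _ => rfl
  have hp : perm (g * mkG (Pi.single a 2) 1) = perm g := by simp [perm_mul, perm_mkG]
  have hne : ∀ i, i ≠ perm g a → zvec (g * mkG (Pi.single a 2) 1) i = zvec g i := by
    intro i hi
    rw [hz, Pi.single_eq_of_ne, add_zero]
    rwa [Ne, Equiv.Perm.inv_eq_iff_eq]
  have h1 := sum_add_eq_sum_add_of_eq_off
    (f := fun i => half (zvec (g * mkG (Pi.single a 2) 1) i)) (f' := fun i => half (zvec g i))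
    (perm g a) (fun i hi => by simp only [hne i hi])
  have h2 : ∑ x, pairCost (g * mkG (Pi.single a 2) 1) x = ∑ x, pairCost g x := by
    refine Finset.sum_congr rfl fun x _ => ?_
    simp only [pairCost, hp]
    by_cases hx : x.1 = perm g a
    · by_cases hij : x.2 < x.1
      · have h3 : (perm g)⁻¹ x.1 < (perm g)⁻¹ x.2 := by
          have h4 : (perm g)⁻¹ x.2 ≠ (perm g)⁻¹ x.1 := fun e => hij.ne ((perm g)⁻¹.injective e)
          have h5 : (perm g)⁻¹ x.1 = a := by simp [hx]
          rw [h5] at h4 ⊢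
          rw [Fin.lt_def, ha]
          exact Nat.pos_of_ne_zero fun e => h4 (Fin.ext (e.trans ha.symm))
        rw [if_pos h3, if_pos h3]
      · rw [if_neg hij, if_neg hij]
    · rw [hne _ hx]
  simp only [zvec_mul_single_two] at h1
  rw [weight, weight, h2]
  omega

namespace IsColoredSwap

variable {c : Fin n → ZMod r} {u v : Fin n}

/-- A recolored digit precedes the other member of the pair both before and after the swap, so the
cost is 1 either way. -/
theorem pairCost_mul (hc : IsColoredSwap c u v) (g : G r n) {i j : Fin n}
    (h1 : ¬((perm g)⁻¹ i = u ∧ (perm g)⁻¹ j = v)) (h2 : ¬((perm g)⁻¹ i = v ∧ (perm g)⁻¹ j = u)) :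
    pairCost (g * mkG c (Equiv.swap u v)) (i, j) = pairCost g (i, j) := by
  simp only [pairCost, inv_perm_mul_apply, swap_lt_swap_iff hc.succ h1 h2]
  by_cases hij : j < i
  · by_cases h0 : c ((perm g)⁻¹ i) = 0
    · rw [zvec_mul, zvec_mkG, h0, add_zero]
    · have h3 := hc.lt_of_ne _ ((perm g)⁻¹ j) h0 (fun e => hij.ne ((perm g)⁻¹.injective e)) h2
      rw [if_pos h3, if_pos h3]
  · rw [if_neg hij, if_neg hij]

end IsColoredSwap

variable [h : Fact (r % 4 = 2)]

namespace IsColoredSwap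

variable {c : Fin n → ZMod r} {u v : Fin n}

theorem half_zvec_mul (hc : IsColoredSwap c u v) (g : G r n) (i : Fin n) :
    half (zvec (g * mkG c (Equiv.swap u v)) i) = half (zvec g i) := by
  rw [zvec_mul, zvec_mkG]
  rcases hc.color_eq ((perm g)⁻¹ i) with h0 | h0
  · rw [h0, add_zero]
  · rw [h0, half_add_half]

theorem sum_half_mul (hc : IsColoredSwap c u v) (g : G r n) :
    ∑ i, half (zvec (g * mkG c (Equiv.swap u v)) i) = ∑ i, half (zvec g i) :=
  Finset.sum_congr rfl fun i _ => hc.half_zvec_mul g i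

/-- Only the swapped pair matters: its cost goes from 0 or 2 to 1, so a nonzero color on the larger
digit makes the weight drop. -/
theorem weight_mul_of_lt (hc : IsColoredSwap c u v) (g : G r n) (hlt : perm g u < perm g v) :
    weight (g * mkG c (Equiv.swap u v)) + (if zvec g (perm g v) = 0 then 0 else 2) =
      weight g + 1 := by
  have huv : u < v := by
    rw [Fin.lt_def, hc.succ]
    omega
  have h1 := sum_add_eq_sum_add_of_eq_off (f := pairCost (g * mkG c (Equiv.swap u v)))
    (f' := pairCost g) (perm g v, perm g u) (fun ⟨i, j⟩ hx => by
      by_cases hij : j < i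
      · refine hc.pairCost_mul g ?_ ?_
        · rintro ⟨rfl, rfl⟩
          exact absurd (by simpa using hlt) hij.not_gt
        · rintro ⟨rfl, rfl⟩
          exact hx (by simp)
      · simp [pairCost, hij])
  have h2 : pairCost (g * mkG c (Equiv.swap u v)) (perm g v, perm g u) = 1 := by
    simp [pairCost, inv_perm_mul_apply, hlt, huv]
  have h3 : pairCost g (perm g v, perm g u) = if zvec g (perm g v) = 0 then 0 else 2 := by
    simp [pairCost, hlt, huv.not_gt]
  rw [weight, weight, hc.sum_half_mul]
  omega

/-- The swapped pair goes from cost 1 to 0 or 2, decided by the new color of the larger digit, which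
moves to the right. -/
theorem weight_mul_of_gt (hc : IsColoredSwap c u v) (g : G r n) (hlt : perm g v < perm g u) :
    weight (g * mkG c (Equiv.swap u v)) + 1 =
      weight g + (if zvec g (perm g u) + c u = 0 then 0 else 2) := by
  have huv : u < v := by
    rw [Fin.lt_def, hc.succ]
    omega
  have h1 := sum_add_eq_sum_add_of_eq_off (f := pairCost (g * mkG c (Equiv.swap u v)))
    (f' := pairCost g) (perm g u, perm g v) (fun ⟨i, j⟩ hx => by
      by_cases hij : j < i
      · refine hc.pairCost_mul g ?_ ?_
        · rintro ⟨rfl, rfl⟩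
          exact hx (by simp)
        · rintro ⟨rfl, rfl⟩
          exact absurd (by simpa using hlt) hij.not_gt
      · simp [pairCost, hij])
  have h2 : pairCost (g * mkG c (Equiv.swap u v)) (perm g u, perm g v) =
      if zvec g (perm g u) + c u = 0 then 0 else 2 := by
    simp [pairCost, inv_perm_mul_apply, hlt, huv.not_gt, zvec_mul, zvec_mkG]
  have h3 : pairCost g (perm g u, perm g v) = 1 := by
    simp [pairCost, hlt, huv]
  rw [weight, weight, hc.sum_half_mul]
  omega

theorem weight_mul_le (hc : IsColoredSwap c u v) (g : G r n) :
    weight (g * mkG c (Equiv.swap u v)) ≤ weight g + 1 := by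
  have hne : perm g u ≠ perm g v := fun e => by
    have h1 := congrArg Fin.val ((perm g).injective e)
    have h2 := hc.succ
    omega
  rcases lt_or_gt_of_ne hne with hlt | hlt
  · have := hc.weight_mul_of_lt g hlt
    omega
  · have := hc.weight_mul_of_gt g hlt
    split_ifs at this <;> omega

end IsColoredSwap

end Weight

/-! ### The generators as colored swaps -/

section Generators

variable {r n : ℕ} [h : Fact (r % 4 = 2)]

theorem coe_aGen_of_eq_zero {i : Fin n} (hi : (i : ℕ) = 0) :
    (aGen (r := r) i : G r n) = mkG (Pi.single i 2) 1 := by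
  simp only [aGen, if_pos hi, sGen, mkG_single_pow, Nat.cast_ofNat]

theorem coe_aGen_of_ne_zero {i : Fin n} (hi : (i : ℕ) ≠ 0) :
    (aGen (r := r) i : G r n) =
      mkG (Pi.single (firstDigit i) ((r / 2 : ℕ) : ZMod r)) (Equiv.swap (predDigit i) i) := by
  simp only [aGen, if_neg hi]
  rw [sGen, if_pos (show ((firstDigit i : Fin n) : ℕ) = 0 from rfl), mkG_single_pow, sGen,
    if_neg hi]
  refine ext_G (fun j => ?_) ?_
  · simp [zvec_mul, zvec_mkG]
  · simp [perm_mul, perm_mkG, predDigit]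

theorem coe_inv_aGen_of_eq_one {i : Fin n} (hi : (i : ℕ) = 1) :
    (((aGen (r := r) i)⁻¹ : A r n) : G r n) =
      mkG (Pi.single i ((r / 2 : ℕ) : ZMod r)) (Equiv.swap (predDigit i) i) := by
  have h0 : firstDigit i = predDigit i := Fin.ext (by simp [firstDigit, predDigit, hi])
  rw [Subgroup.coe_inv, coe_aGen_of_ne_zero (by omega), h0]
  refine inv_eq_of_mul_eq_one_right (ext_G (fun j => ?_) ?_)
  · rw [zvec_mul, zvec_mkG, zvec_mkG, perm_mkG, Equiv.swap_inv]
    by_cases hj : j = predDigit i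
    · rw [hj, Equiv.swap_apply_left, Pi.single_eq_same, Pi.single_eq_same,
        natCast_half_add_self]
      rfl
    · rw [Pi.single_eq_of_ne hj, Pi.single_eq_of_ne, add_zero]
      · rfl
      · rwa [Ne, Equiv.swap_apply_eq_iff, Equiv.swap_apply_right]
  · exact Equiv.swap_mul_self _ _

theorem coe_inv_aGen_of_one_lt {i : Fin n} (hi : 1 < (i : ℕ)) :
    (((aGen (r := r) i)⁻¹ : A r n) : G r n) =
      mkG (Pi.single (firstDigit i) ((r / 2 : ℕ) : ZMod r)) (Equiv.swap (predDigit i) i) := by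
  rw [Subgroup.coe_inv, coe_aGen_of_ne_zero (by omega)]
  have h1 : firstDigit i ≠ predDigit i := fun e => by
    have := congrArg Fin.val e
    simp only [firstDigit, predDigit] at this
    omega
  have h2 : firstDigit i ≠ i := fun e => by
    have := congrArg Fin.val e
    simp only [firstDigit] at this
    omega
  refine inv_eq_of_mul_eq_one_right (ext_G (fun j => ?_) ?_)
  · rw [zvec_mul, zvec_mkG, zvec_mkG, perm_mkG, Equiv.swap_inv]
    by_cases hj : j = firstDigit i
    · rw [hj, Equiv.swap_apply_of_ne_of_ne h1 h2, Pi.single_eq_same, natCast_half_add_self]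
      rfl
    · rw [Pi.single_eq_of_ne hj, Pi.single_eq_of_ne, add_zero]
      · rfl
      · rwa [Ne, Equiv.swap_apply_eq_iff, Equiv.swap_apply_of_ne_of_ne h1 h2]
  · exact Equiv.swap_mul_self _ _

theorem weight_mul_le {s : A r n} (hs : s ∈ aGenSet r n) (g : G r n) :
    weight (g * (s : G r n)) ≤ weight g + 1 := by
  rcases hs with ⟨i, rfl⟩ | ⟨i, hi, rfl⟩
  · by_cases hi : (i : ℕ) = 0
    · have h1 := weight_mul_two_add g i hi
      rw [← coe_aGen_of_eq_zero hi] at h1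
      rcases half_add_two (zvec g (perm g i)) with h2 | h2 <;> omega
    · rw [coe_aGen_of_ne_zero hi]
      exact (isColoredSwap_single hi (Or.inl rfl)).weight_mul_le g
  · rw [coe_inv_aGen_of_eq_one hi]
    exact (isColoredSwap_single (by omega) (Or.inr ⟨hi, rfl⟩)).weight_mul_le g

end Generators

/-! ### Descents and the length formula -/

section Length

variable {r n : ℕ} [h : Fact (r % 4 = 2)]

theorem aGen_mem_aGenSet (i : Fin n) : (aGen i : A r n) ∈ aGenSet r n := Or.inl ⟨i, rfl⟩

theorem exists_descent_of_half_ne_zero (g : A r n) {a : Fin n} (ha : (a : ℕ) = 0)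
    (hg : half (zvec (g : G r n) (perm (g : G r n) a)) ≠ 0) :
    ∃ s ∈ aGenSet r n, weight ((g : G r n) * ((s⁻¹ : A r n) : G r n)) + 1 =
      weight (g : G r n) := by
  refine ⟨aGen a, aGen_mem_aGenSet a, ?_⟩
  -- Written from g', the nonzero half in `hg` rules out wrap-around in `half_add_two`.
  obtain ⟨g', rfl⟩ : ∃ g', g = g' * aGen a := ⟨g * (aGen a)⁻¹, by group⟩
  have hp : perm (((g' * aGen a : A r n)) : G r n) = perm (g' : G r n) := by
    rw [Subgroup.coe_mul, coe_aGen_of_eq_zero ha]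
    simp [perm_mul, perm_mkG]
  rw [hp, Subgroup.coe_mul, coe_aGen_of_eq_zero ha, zvec_mul_single_two] at hg
  rw [← Subgroup.coe_mul, mul_inv_cancel_right, Subgroup.coe_mul, coe_aGen_of_eq_zero ha]
  have h1 := weight_mul_two_add (g' : G r n) a ha
  rcases half_add_two (zvec (g' : G r n) (perm (g' : G r n) a)) with h2 | h2
  · exact absurd h2 hg
  · omega

theorem exists_coloredSwap (i : Fin n) (hi : (i : ℕ) ≠ 0) :
    ∃ s ∈ aGenSet r n, ∃ c, IsColoredSwap (r := r) c (predDigit i) i ∧ c (predDigit i) = 0 ∧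
      ((s⁻¹ : A r n) : G r n) = mkG c (Equiv.swap (predDigit i) i) := by
  by_cases h1 : (i : ℕ) = 1
  · refine ⟨aGen i, aGen_mem_aGenSet i, _, isColoredSwap_single hi (Or.inr ⟨h1, rfl⟩), ?_,
      coe_inv_aGen_of_eq_one h1⟩
    refine Pi.single_eq_of_ne (fun e => ?_) _
    have := congrArg Fin.val e
    simp only [predDigit] at this
    omega
  · refine ⟨aGen i, aGen_mem_aGenSet i, _, isColoredSwap_single hi (Or.inl rfl), ?_,
      coe_inv_aGen_of_one_lt (by omega)⟩
    refine Pi.single_eq_of_ne (fun e => ?_) _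
    have := congrArg Fin.val e
    simp only [predDigit, firstDigit] at this
    omega

/-- At the first two places the swap can also recolor the digit moving right; this is why the
inverse of a_1 is needed as a generator. -/
theorem exists_coloredSwap_half (i : Fin n) (hi : (i : ℕ) = 1) :
    ∃ s ∈ aGenSet r n, ∃ c, IsColoredSwap (r := r) c (predDigit i) i ∧
      c (predDigit i) = (r / 2 : ℕ) ∧
      ((s⁻¹ : A r n) : G r n) = mkG c (Equiv.swap (predDigit i) i) := by
  have h0 : firstDigit i = predDigit i := Fin.ext (by simp [firstDigit, predDigit, hi])
  refine ⟨(aGen i)⁻¹, Or.inr ⟨i, hi, rfl⟩, _,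
    isColoredSwap_single (a := firstDigit i) (by omega) (Or.inl rfl), ?_, ?_⟩
  · rw [h0, Pi.single_eq_same]
  · rw [inv_inv, coe_aGen_of_ne_zero (by omega)]

/-- If no generator lowers the weight, the larger digit of each adjacent ascent has color 0 and that
of each adjacent descent a nonzero color. Working from the left, this excludes all descents, so the
permutation is trivial, and the parity constraint settles the first color. -/
theorem exists_descent (g : A r n) (hg : g ≠ 1) :
    ∃ s ∈ aGenSet r n, weight ((g : G r n) * ((s⁻¹ : A r n) : G r n)) + 1 =
      weight (g : G r n) := by
  by_contra hno
  cases n with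
  | zero => exact hg (Subtype.ext (ext_G (fun i => i.elim0) (Subsingleton.elim _ _)))
  | succ n =>
  have hfirst : half (zvec (g : G r (n + 1)) (perm (g : G r (n + 1)) 0)) = 0 := by
    by_contra h0
    exact hno (exists_descent_of_half_ne_zero g rfl h0)
  have hplain : ∀ i : Fin n, perm (g : G r (n + 1)) i.castSucc < perm (g : G r (n + 1)) i.succ →
      zvec (g : G r (n + 1)) (perm (g : G r (n + 1)) i.succ) = 0 := by
    intro i hlt
    by_contra h0
    obtain ⟨s, hs, c, hc, -, hsc⟩ := exists_coloredSwap (r := r) i.succ (by simp)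
    refine hno ⟨s, hs, ?_⟩
    have h1 := hc.weight_mul_of_lt (g : G r (n + 1)) hlt
    rw [if_neg h0] at h1
    rw [hsc]
    omega
  have hmark : ∀ i : Fin n, perm (g : G r (n + 1)) i.succ < perm (g : G r (n + 1)) i.castSucc →
      zvec (g : G r (n + 1)) (perm (g : G r (n + 1)) i.castSucc) ≠ 0 := by
    intro i hlt h0
    obtain ⟨s, hs, c, hc, hc0, hsc⟩ := exists_coloredSwap (r := r) i.succ (by simp)
    refine hno ⟨s, hs, ?_⟩
    have h1 := hc.weight_mul_of_gt (g : G r (n + 1)) hlt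
    have h2 : zvec (g : G r (n + 1)) (perm (g : G r (n + 1)) (predDigit i.succ)) = 0 := h0
    rw [hc0, add_zero, if_pos h2] at h1
    rw [hsc]
    omega
  have hasc : ∀ i : Fin n,
      perm (g : G r (n + 1)) i.castSucc < perm (g : G r (n + 1)) i.succ := by
    rintro ⟨k, hk⟩
    induction k with
    | zero =>
      by_contra hge
      have hlt := lt_of_le_of_ne (not_lt.1 hge) fun e => by
        simpa [Fin.ext_iff] using (perm (g : G r (n + 1))).injective e
      -- A first digit of color 0 contradicts `hmark`; color r/2 is cancelled by the recoloring
      -- swap.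
      rcases half_eq_zero_iff.1 hfirst with h0 | h0
      · exact hmark _ hlt h0
      · obtain ⟨s, hs, c, hc, hc0, hsc⟩ :=
          exists_coloredSwap_half (r := r) (⟨0, hk⟩ : Fin n).succ rfl
        refine hno ⟨s, hs, ?_⟩
        have h1 := hc.weight_mul_of_gt (g : G r (n + 1)) hlt
        have h2 : zvec (g : G r (n + 1)) (perm (g : G r (n + 1))
            (predDigit (⟨0, hk⟩ : Fin n).succ)) = (r / 2 : ℕ) := h0
        rw [hc0, h2, natCast_half_add_self, if_pos rfl] at h1
        rw [hsc]
        omega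
    | succ k ih =>
      by_contra hge
      have hlt := lt_of_le_of_ne (not_lt.1 hge) fun e => by
        simpa [Fin.ext_iff] using (perm (g : G r (n + 1))).injective e
      -- The preceding ascent forces color 0 on the digit starting this descent.
      exact hmark _ hlt (hplain _ (ih (by omega)))
  have hperm : perm (g : G r (n + 1)) = 1 := by
    have hmono : StrictMono (perm (g : G r (n + 1))) := Fin.strictMono_iff_lt_succ.2 hasc
    exact Equiv.ext (congrFun hmono.eq_id)
  refine hg (Subtype.ext (eq_of_zvec_eq_off g.2 (A r (n + 1)).one_mem 0 hperm ?_ ?_))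
  · intro i hi
    obtain ⟨j, rfl⟩ := Fin.exists_succ_eq.2 hi
    have h1 := hplain j (hasc j)
    rw [hperm] at h1
    exact h1
  · rw [hperm] at hfirst
    exact hfirst.trans half_zero.symm

theorem lengthA_eq_weight (g : A r n) : lengthA g = weight (g : G r n) :=
  wordLength_eq_of_descent (L := fun g : A r n => weight (g : G r n)) weight_one
    (fun g _ hs => weight_mul_le hs (g : G r n)) exists_descent g

end Length

/-! ### Fibers of the covering map -/

section Fiber

variable {r n : ℕ}

/-- Of the smaller digits, l_i lie to the right of i and cost 1 each; the remaining ones cost 2 each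
exactly when z_i ≠ 0. Since `Fin n` starts at 0, i itself counts the smaller digits. -/
theorem sum_pairCost (g : G r n) (i : Fin n) :
    (∑ j, pairCost g (i, j) : ℤ) = lehmer (perm g) i +
      if zvec g i = 0 then 0 else 2 * ((i : ℤ) - lehmer (perm g) i) := by
  have h1 : ((i : ℕ) : ℤ) = ∑ j, if j < i then 1 else 0 := by
    rw [Finset.sum_boole, Finset.filter_gt_eq_Iio, Fin.card_Iio]
  have h2 : (lehmer (perm g) i : ℤ) =
      ∑ j, if j < i ∧ (perm g)⁻¹ i < (perm g)⁻¹ j then 1 else 0 := by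
    rw [Finset.sum_boole, lehmer]
  rw [h1, h2]
  simp only [pairCost]
  by_cases h0 : zvec g i = 0
  · simp only [h0, if_true, add_zero]
    push_cast
    refine Finset.sum_congr rfl fun j _ => ?_
    by_cases hj : j < i <;> simp [hj]
  · simp only [h0, if_false, ← Finset.sum_sub_distrib, Finset.mul_sum, ← Finset.sum_add_distrib]
    refine Finset.sum_congr rfl fun j _ => ?_
    by_cases hj : j < i
    · by_cases hj' : (perm g)⁻¹ i < (perm g)⁻¹ j
      · simp only [hj, hj', and_self, if_true]
        norm_num
      · simp only [hj, hj', and_false, if_true, if_false]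
        norm_num
    · simp [hj]

theorem weight_sub_weight {g g' : G r n} (hp : perm g = perm g')
    (hz : ∀ i, half (zvec g i) = half (zvec g' i)) :
    (weight g : ℤ) - weight g' = ∑ i, ((if zvec g i = 0 then 0 else 1) -
      (if zvec g' i = 0 then 0 else 1)) * (2 * ((i : ℤ) - lehmer (perm g') i)) := by
  simp only [weight, Fintype.sum_prod_type]
  push_cast
  simp only [sum_pairCost, hz, hp]
  rw [add_sub_add_left_eq_sub, ← Finset.sum_sub_distrib]
  refine Finset.sum_congr rfl fun i _ => ?_
  split_ifs <;> ring

variable [h : Fact (r % 4 = 2)]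

theorem neZero_half : NeZero (r / 2) :=
  ⟨by have := h.out; omega⟩

theorem zvec_p (g : A r n) (i : Fin n) :
    zvec (p g) i = (half (zvec (g : G r n) i) : ZMod (r / 2)) := rfl

theorem color_p (g : A r n) (i : Fin n) : color (p g) i = half (zvec (g : G r n) i) := by
  rw [color_eq, zvec_p, ZMod.val_natCast, Nat.mod_eq_of_lt (half_lt _)]

theorem p_eq_p_iff {g g' : A r n} : p g = p g' ↔ perm (g : G r n) = perm (g' : G r n) ∧
    ∀ i, half (zvec (g : G r n) i) = half (zvec (g' : G r n) i) := by
  constructor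
  · intro e
    exact ⟨congrArg (perm (r := r / 2)) e, fun i => by rw [← color_p, e, color_p]⟩
  · rintro ⟨hp, hz⟩
    exact ext_G (fun i => by rw [zvec_p, zvec_p, hz]) hp

theorem zvec_sec (c : G (r / 2) n) (i : Fin n) :
    zvec (sec c : G r n) i = sectionColor c i := rfl

theorem p_sec (c : G (r / 2) n) : p (sec c : A r n) = c := by
  have := neZero_half (r := r)
  refine ext_G (fun i => ?_) rfl
  have hc : color c i < r / 2 := ZMod.val_lt (zvec c i)
  have h1 : half (sectionColor c i : ZMod r) = color c i := by
    unfold sectionColor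
    split_ifs
    · rw [Nat.cast_add, half_add_half, half_two_mul hc]
    · exact half_two_mul hc
  rw [zvec_p, zvec_sec, h1, color_eq, ZMod.natCast_zmod_val]

theorem zvec_sec_eq_zero_iff (c : G (r / 2) n) {i : Fin n} (hi : (i : ℕ) ≠ 0) :
    zvec (sec c : G r n) i = 0 ↔ half (zvec (sec c : G r n) i) = 0 := by
  have := neZero_half (r := r)
  have hc : color c i < r / 2 := ZMod.val_lt (zvec c i)
  rw [zvec_sec, sectionColor, if_neg (fun e => hi e.1), half_two_mul hc]
  constructor
  · intro h0
    rw [← half_two_mul hc, h0, half_zero]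
  · intro h0
    simp [h0]

/-- The positions, other than the smallest digit, where the colors of `g` and `g'` differ. -/
def diffSet (g g' : A r n) : Finset (Fin n) :=
  {i | 1 ≤ (i : ℕ) ∧ zvec (g : G r n) i ≠ zvec (g' : G r n) i}

theorem mem_diffSet {g g' : A r n} {i : Fin n} :
    i ∈ diffSet g g' ↔ 1 ≤ (i : ℕ) ∧ zvec (g : G r n) i ≠ zvec (g' : G r n) i := by
  simp [diffSet]

/-- At a differing digit, half zero means color 0 in the section and nonzero in σ; half nonzero
means both colors are nonzero and the term vanishes. -/
theorem fibralLength_eq_sum {π σ : A r n} (hσ : σ ∈ fiber π) :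
    fibralLength σ = ∑ i ∈ diffSet σ (sec (p π)), 2 * (delta (π : G r n) i : ℤ) *
      (((i : ℕ) : ℤ) - (lehmer (perm (π : G r n)) i : ℤ)) := by
  have hσπ : p σ = p π := hσ
  have hsec : p (sec (p π) : A r n) = p π := p_sec _
  obtain ⟨hp, hz⟩ := p_eq_p_iff.1 (hσπ.trans hsec.symm)
  obtain ⟨-, hz'⟩ := p_eq_p_iff.1 hsec
  have hp' : perm (sec (p π) : G r n) = perm (π : G r n) := rfl
  rw [fibralLength, hσπ, lengthA_eq_weight, lengthA_eq_weight, weight_sub_weight hp hz,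
    ← Finset.sum_subset (subset_univ (diffSet σ (sec (p π)))) (fun i _ hi => ?_), hp']
  · refine Finset.sum_congr rfl fun i hi => ?_
    rw [mem_diffSet] at hi
    have h1 := zvec_sec_eq_zero_iff (r := r) (p π) (i := i) (by omega)
    rw [delta_eq, ← hz' i]
    by_cases h0 : zvec (sec (p π) : G r n) i = 0
    · rw [if_pos h0, if_pos (h1.1 h0), if_neg (fun e => hi.2 (e.trans h0.symm))]
      push_cast
      ring
    · have h2 : zvec (σ : G r n) i ≠ 0 := by
        intro e
        have h3 := hz i
        rw [e, half_zero] at h3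
        exact h0 (h1.2 h3.symm)
      rw [if_neg h0, if_neg h2, if_neg (fun e => h0 (h1.2 e))]
      push_cast
      ring
  · rw [mem_diffSet, not_and_or, not_not] at hi
    -- The smallest digit may change color, but no digit is below it, so its coefficient is 0.
    rcases hi with hi | hi
    · have h0 : (i : ℕ) = 0 := by omega
      have h1 : lehmer (perm (sec (p π) : G r n)) i = 0 := by
        rw [lehmer, Finset.card_eq_zero, Finset.filter_eq_empty_iff]
        rintro j - ⟨hj, -⟩
        rw [Fin.lt_def] at hj
        omega
      simp [h0, h1]
    · simp [hi]

/-- Each color in the fiber has two possible values, so the set fixes all colors but that of the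
smallest digit, which parity then fixes. -/
theorem diffSet_injOn (π g' : A r n) (hn : 1 ≤ n) (hg' : g' ∈ fiber π) :
    Set.InjOn (fun σ => diffSet σ g') (fiber π) := by
  intro σ hσ σ' hσ' e
  have h1 : p σ = p σ' := Eq.trans hσ (Eq.symm hσ')
  obtain ⟨hp, hz⟩ := p_eq_p_iff.1 h1
  obtain ⟨-, hzg⟩ := p_eq_p_iff.1 (Eq.trans hg' (Eq.symm hσ) : p g' = p σ)
  refine Subtype.ext (eq_of_zvec_eq_off σ.2 σ'.2 ⟨0, hn⟩ hp (fun i hi => ?_) (hz _))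
  have hi' : 1 ≤ (i : ℕ) := Nat.pos_of_ne_zero fun e => hi (Fin.ext e)
  have h2 : i ∈ diffSet σ g' ↔ i ∈ diffSet σ' g' := by rw [show diffSet σ g' = diffSet σ' g' from e]
  simp only [mem_diffSet, hi', true_and] at h2
  rcases eq_or_eq_add_half (hzg i) with h3 | h3 <;>
    rcases eq_or_eq_add_half ((hzg i).trans (hz i)) with h4 | h4
  · rw [h3, h4]
  · exact absurd h3 (h2.2 (by rw [h4]; simpa using natCast_half_ne_zero))
  · exact absurd h4 (h2.1 (by rw [h3]; simpa using natCast_half_ne_zero))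
  · rw [h3, h4]

theorem mkG_add_half_mem {g : G r n} (hg : g ∈ A r n) {t : Finset (Fin n)} (ht : Even #t) :
    mkG (fun i => zvec g i + if i ∈ t then ((r / 2 : ℕ) : ZMod r) else 0) (perm g) ∈ A r n := by
  rw [A, MonoidHom.mem_ker, signChar_apply] at hg ⊢
  simp only [zvec_mkG, perm_mkG, neg_one_pow_val_add, Finset.prod_mul_distrib]
  have h1 : ∀ i, (-1 : ℤˣ) ^ (if i ∈ t then ((r / 2 : ℕ) : ZMod r) else 0).val =
      if i ∈ t then -1 else 1 := by
    intro i
    split_ifs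
    · exact neg_one_pow_val_half
    · simp
  rw [Finset.prod_congr rfl fun i _ => h1 i, Finset.prod_ite_mem, Finset.univ_inter,
    Finset.prod_const, ht.neg_one_pow, mul_one, hg]

theorem exists_diffSet_eq (π g' : A r n) (hn : 1 ≤ n) (hg' : g' ∈ fiber π)
    {t : Finset (Fin n)} (ht : ∀ i ∈ t, 1 ≤ (i : ℕ)) : ∃ σ ∈ fiber π, diffSet σ g' = t := by
  -- The smallest digit is added when needed to make the number of shifts by r/2 even.
  obtain ⟨t', heven, ht'⟩ : ∃ t' : Finset (Fin n), Even #t' ∧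
      ∀ i : Fin n, 1 ≤ (i : ℕ) → (i ∈ t' ↔ i ∈ t) := by
    rcases Nat.even_or_odd (#t) with he | ho
    · exact ⟨t, he, fun _ _ => Iff.rfl⟩
    · refine ⟨insert ⟨0, hn⟩ t, ?_, fun i hi => ?_⟩
      · rw [Finset.card_insert_of_notMem fun h0 => absurd (ht _ h0) (by simp)]
        exact ho.add_one
      · rw [Finset.mem_insert, or_iff_right]
        rintro rfl
        simp at hi
  refine ⟨⟨_, mkG_add_half_mem g'.2 heven⟩, ?_, ?_⟩
  · rw [fiber, Set.mem_ofPred_eq, ← show p g' = p π from hg', p_eq_p_iff]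
    refine ⟨rfl, fun i => ?_⟩
    simp only [zvec_mkG]
    split_ifs
    · exact half_add_half _
    · rw [add_zero]
  · ext i
    rw [mem_diffSet]
    simp only [zvec_mkG]
    constructor
    · rintro ⟨hi, hne⟩
      by_contra hit
      rw [← ht' i hi] at hit
      simp [hit] at hne
    · intro hit
      have hi := ht i hit
      refine ⟨hi, ?_⟩
      rw [if_pos ((ht' i hi).2 hit)]
      simpa using natCast_half_ne_zero

theorem T_sum {ι : Type*} (s : Finset ι) (f : ι → ℤ) :
    (LaurentPolynomial.T (∑ i ∈ s, f i) : LaurentPolynomial ℤ) =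
      ∏ i ∈ s, LaurentPolynomial.T (f i) := by
  classical
  induction s using Finset.induction_on with
  | empty => simp
  | insert i s hi ih => rw [Finset.sum_insert hi, Finset.prod_insert hi, LaurentPolynomial.T_add, ih]

end Fiber

end ColoredPerm

/-! ### Factorisation of the fibral length distribution -/

theorem mainTheorem10 (r n : ℕ) [Fact (r % 4 = 2)] (hn : 1 ≤ n) (π : ColoredPerm.A r n) :
    ColoredPerm.fiberDistribution π =
      ∏ i ∈ Finset.univ.filter (fun i : Fin n => 1 ≤ (i : ℕ)),
        (1 + LaurentPolynomial.T
          (2 * (ColoredPerm.delta (π : ColoredPerm.G r n) i : ℤ) *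
            (((i : ℕ) : ℤ) -
              (ColoredPerm.lehmer (ColoredPerm.perm (π : ColoredPerm.G r n)) i : ℤ))) :
          LaurentPolynomial ℤ) := by
  have hsec : ColoredPerm.sec (ColoredPerm.p π) ∈ ColoredPerm.fiber π := ColoredPerm.p_sec _
  -- Expanding the product gives one term per subset of the digits other than the smallest, to be
  -- matched with the fiber through `diffSet`.
  rw [Finset.prod_one_add, ColoredPerm.fiberDistribution]
  refine Finset.sum_nbij
    (fun σ => ColoredPerm.diffSet σ (ColoredPerm.sec (ColoredPerm.p π))) ?_ ?_ ?_ ?_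
  · intro σ _
    rw [Finset.mem_powerset]
    intro i hi
    simpa using (ColoredPerm.mem_diffSet.1 hi).1
  · rw [Set.Finite.coe_toFinset]
    exact ColoredPerm.diffSet_injOn π _ hn hsec
  · intro t ht
    rw [Set.Finite.coe_toFinset]
    refine ColoredPerm.exists_diffSet_eq π _ hn hsec fun i hi => ?_
    simpa using Finset.mem_powerset.1 ht hi
  · intro σ hσ
    rw [Set.Finite.mem_toFinset] at hσ
    rw [ColoredPerm.fibralLength_eq_sum hσ, ColoredPerm.T_sum]
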